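/- Let $X_g=\{(x,y)\in\mathbb{R}^2 : xy=0\}$ be the union of the two coordinate axes with the gluing diffeology, i.e. the quotient diffeology obtained from $(\mathbb{R}\times\{0\})\sqcup(\{0\}\times\mathbb{R})$ by identifying the two origins (equivalently, the smallest diffeology for which the inclusions of the two axes are smooth). For a diffeological space $X$, a differential $1$-form $\omega\in\Omega^1(X)$ is a family of smooth $1$-forms $\omega_p\in\Omega^1(U)$, one for each plot $p:U\to X$, with $\omega_{p\circ f}=f^*\omega_p$ for every smooth map $f$ between the domains of plots; $\Omega^1(X)$ has the diffeology in which a map $V\to\Omega^1(X)$ is a plot if and only if each component $V\to\Omega^1(U)$ is smooth. The form $\omega$ vanishes at $x\in X$ if $\omega_p(0)=0$ for every plot $p$ with $p(0)=x$. Let $dx,dy\in\Omega^1(X_g)$ be the pullbacks of $dx,dy\in\Omega^1(\mathbb{R}^2)$ along the inclusion $X_g\to\mathbb{R}^2$, and give $C^\infty(\mathbb{R},\mathbb{R})$ the functional diffeology. Then $$\Omega^1(X_g)=\{f(x)\,dx+g(y)\,dy \mid f,g\in C^\infty(\mathbb{R},\mathbb{R})\},$$ and the map $(f,g)\mapsto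 f(x)\,dx+g(y)\,dy$ is an isomorphism of diffeological vector spaces (a linear diffeomorphism) $$C^\infty(\mathbb{R},\mathbb{R})\times C^\infty(\mathbb{R},\mathbb{R})\;\cong\;\Omega^1(X_g).$$ Here $dx$ vanishes at every point not on the $x$-axis, and $dy$ vanishes at every point not on the $y$-axis. Let $\pi: T^{\mathrm{dvs}}X_g\to X_g$ be the internal tangent bundle: its fibre over $z$ is the colimit of the tangent spaces $T_uU$ over all plots $p:U\to X_g$ with a chosen point $u$, $p(u)=z$, and its total space has the smallest diffeology for which all the induced maps $TU\to T^{\mathrm{dvs}}X_g$ are smooth and $\pi$ is a diffeological vector pseudo-bundle ($\pi$, the fibrewise addition, the fibrewise scalar multiplication and the zero section are smooth). Let $(T^{\mathrm{dvs}}X_g)^*\to X_g$ be its dual bundle: the fibre over $z$ is the space of smooth linear maps $T^{\mathrm{dvs}}_zX_g\to\mathbb{R}$, and a map $p:U\to(T^{\mathrm{dvs}}X_g)^*$ is a plot if and only if its projection to $X_g$ and the evaluation map $U\times_{X_g}T^{\mathrm{dvs}}X_g\to\mathbb{R}$, $(u,v)\mapsto p(u)(v)$, are smooth. Then $(T^{\mathrm{dvs}}X_g)^*\to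 X_g$ has a smooth section that is nonzero at the origin, whereas every smooth section of $T^{\mathrm{dvs}}X_g\to X_g$ (every vector field on $X_g$) vanishes at the origin. -/

import Mathlib

open Diffeology
open scoped ContDiff

noncomputable section

namespace AxesForms

/-- The Cartesian space `ℝⁿ`. Plots are maps from these: as every open set is covered by copies of
`ℝⁿ`, they determine the plots on all open subsets of Cartesian spaces. -/
abbrev Euc (n : ℕ) : Type := EuclideanSpace ℝ (Fin n)

/-! ## Basic constructions on diffeological spaces -/

/-- A map that is a plot in a neighbourhood of each point is a plot. -/
theorem isPlot_of_local {X : Type*} [DiffeologicalSpace X] {n : ℕ} {p : Euc n → X}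
    (h : ∀ x : Euc n, ∃ u : Set (Euc n), IsOpen u ∧ x ∈ u ∧
      ∀ (m : ℕ) (f : Euc m → Euc n), (∀ t, f t ∈ u) → ContDiff ℝ ∞ f → IsPlot (p ∘ f)) :
    IsPlot p :=
  DiffeologicalSpace.locality fun x => by
    obtain ⟨u, hu, hx, hf⟩ := h x
    exact ⟨u, hu, hx, fun {m f} h1 h2 => hf m f h1 h2⟩

/-- The product diffeology: a plot is a pair of plots. -/
instance instProd {X Y : Type*} [DiffeologicalSpace X] [DiffeologicalSpace Y] :
    DiffeologicalSpace (X × Y) where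
  plots n := {p | IsPlot (fun t => (p t).1) ∧ IsPlot (fun t => (p t).2)}
  constant_plots _ := ⟨isPlot_const, isPlot_const⟩
  plot_reparam hp hf := ⟨isPlot_reparam hp.1 hf, isPlot_reparam hp.2 hf⟩
  locality h := by
    refine ⟨isPlot_of_local fun x => ?_, isPlot_of_local fun x => ?_⟩
    · obtain ⟨u, hu, hx, hf⟩ := h x
      exact ⟨u, hu, hx, fun m f h1 h2 => (hf h1 h2).1⟩
    · obtain ⟨u, hu, hx, hf⟩ := h x
      exact ⟨u, hu, hx, fun m f h1 h2 => (hf h1 h2).2⟩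

/-- The pullback of a diffeology along a map `i`: `p` is a plot iff `i ∘ p` is one.  For injective
`i` this is the subset diffeology. -/
@[reducible]
def inducedDiffeology {X Y : Type*} [DiffeologicalSpace Y] (i : X → Y) :
    DiffeologicalSpace X where
  plots n := {p | IsPlot (i ∘ p)}
  constant_plots _ := isPlot_const
  plot_reparam hp hf := isPlot_reparam hp hf
  locality h := isPlot_of_local fun x => by
    obtain ⟨u, hu, hx, hf⟩ := h x
    exact ⟨u, hu, hx, fun m f h1 h2 => hf h1 h2⟩

/-- A diffeological vector space: addition and scalar multiplication are smooth. -/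
class DiffeologicalVectorSpace (V : Type*) [AddCommGroup V] [Module ℝ V]
    [DiffeologicalSpace V] : Prop where
  smooth_add : DSmooth (fun z : V × V => z.1 + z.2)
  smooth_smul : DSmooth (fun z : ℝ × V => z.1 • z.2)

instance {V W : Type*} [AddCommGroup V] [Module ℝ V] [DiffeologicalSpace V]
    [AddCommGroup W] [Module ℝ W] [DiffeologicalSpace W]
    [DiffeologicalVectorSpace V] [DiffeologicalVectorSpace W] :
    DiffeologicalVectorSpace (V × W) where
  smooth_add n p hp :=
    ⟨DiffeologicalVectorSpace.smooth_add n (fun t => ((p t).1.1, (p t).2.1)) ⟨hp.1.1, hp.2.1⟩,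
      DiffeologicalVectorSpace.smooth_add n (fun t => ((p t).1.2, (p t).2.2)) ⟨hp.1.2, hp.2.2⟩⟩
  smooth_smul n p hp :=
    ⟨DiffeologicalVectorSpace.smooth_smul n (fun t => ((p t).1, (p t).2.1)) ⟨hp.1, hp.2.1⟩,
      DiffeologicalVectorSpace.smooth_smul n (fun t => ((p t).1, (p t).2.2)) ⟨hp.1, hp.2.2⟩⟩

/-- An isomorphism of diffeological vector spaces: a linear isomorphism that is a
diffeomorphism. -/
structure DVSEquiv (V W : Type*) [AddCommGroup V] [Module ℝ V] [DiffeologicalSpace V]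
    [DiffeologicalVectorSpace V] [AddCommGroup W] [Module ℝ W] [DiffeologicalSpace W]
    [DiffeologicalVectorSpace W] where
  toLinearEquiv : V ≃ₗ[ℝ] W
  smooth_toFun : DSmooth toLinearEquiv
  smooth_invFun : DSmooth toLinearEquiv.symm

/-! ## Smooth real functions -/

/-- `C^∞(X, ℝ)`. -/
def CInf (X : Type*) [DiffeologicalSpace X] : Subalgebra ℝ (X → ℝ) where
  carrier := {f | DSmooth f}
  add_mem' hf hg n p hp :=
    ((hf n p hp).contDiff.add (hg n p hp).contDiff).isPlot
  mul_mem' hf hg n p hp :=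
    ((hf n p hp).contDiff.mul (hg n p hp).contDiff).isPlot
  algebraMap_mem' _ := dSmooth_const

/-- The functional diffeology on `C^∞(X, ℝ)`: `w : V → C^∞(X, ℝ)` is a plot iff
`(v, x) ↦ w v x` is smooth on `V × X`. -/
instance instCInf (X : Type*) [DiffeologicalSpace X] : DiffeologicalSpace (CInf X) where
  plots n := {w | DSmooth (fun z : Euc n × X => (w z.1).1 z.2)}
  constant_plots f := fun n p hp => f.2 n _ hp.2
  plot_reparam hw hf := fun n p hp =>
    hw n (fun t => (_, (p t).2)) ⟨(hf.comp hp.1.contDiff).isPlot, hp.2⟩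
  locality {n w} h := fun k p hp => isPlot_of_local fun t => by
    obtain ⟨u, hu, hx, hf⟩ := h (p t).1
    refine ⟨(fun t => (p t).1) ⁻¹' u, hu.preimage hp.1.contDiff.continuous, hx, ?_⟩
    intro m g hgu hg
    exact hf (f := fun s => (p (g s)).1) hgu (hp.1.contDiff.comp hg) m
      (fun s => (s, (p (g s)).2)) ⟨isPlot_id, isPlot_reparam hp.2 hg⟩

instance (X : Type*) [DiffeologicalSpace X] : DiffeologicalVectorSpace (CInf X) where
  smooth_add _ _ hp := fun k q hq =>
    (((hp.1 k q hq).contDiff).add ((hp.2 k q hq).contDiff)).isPlot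
  smooth_smul _ _ hp := fun k q hq =>
    ((hp.1.contDiff.comp hq.1.contDiff).mul ((hp.2 k q hq).contDiff)).isPlot

/-- Precomposition of a smooth real function with a smooth map. -/
def CInf.comp {X Y : Type*} [DiffeologicalSpace X] [DiffeologicalSpace Y]
    (f : CInf Y) (h : X → Y) (hh : DSmooth h) : CInf X :=
  ⟨fun x => f.1 (h x), f.2.comp hh⟩

/-! ## Differential `1`-forms -/

/-- `Ω¹(X)`: families `η_p ∈ Ω¹(ℝⁿ)`, one for each plot `p : ℝⁿ → X`, with
`η_{p ∘ f} = f^* η_p` for each smooth `f`. -/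
def Omega1 (X : Type*) [DiffeologicalSpace X] :
    Submodule ℝ (∀ n : ℕ, {p : Euc n → X // IsPlot p} → Euc n → (Euc n →L[ℝ] ℝ)) where
  carrier := {η | (∀ n p, ContDiff ℝ ∞ (η n p)) ∧
    ∀ (m n : ℕ) (p : {p : Euc n → X // IsPlot p}) (f : Euc m → Euc n) (hf : ContDiff ℝ ∞ f)
      (u : Euc m), η m ⟨p.1 ∘ f, isPlot_reparam p.2 hf⟩ u = (η n p (f u)).comp (fderiv ℝ f u)}
  add_mem' ha hb := ⟨fun n p => (ha.1 n p).add (hb.1 n p), fun m n p f hf u => by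
    simp [ha.2 m n p f hf u, hb.2 m n p f hf u]⟩
  zero_mem' := ⟨fun n p => contDiff_const, fun m n p f hf u => by simp⟩
  smul_mem' c a ha := ⟨fun n p => (ha.1 n p).const_smul c, fun m n p f hf u => by
    simp [ha.2 m n p f hf u]⟩

/-- The diffeology of `Ω¹(X) = lim Ω¹(ℝⁿ)`: a map `w : V → Ω¹(X)` is a plot iff each component
`V → Ω¹(ℝⁿ) = C^∞(ℝⁿ, (ℝⁿ)*)` is smooth for the functional diffeology. -/
instance instOmega1 (X : Type*) [DiffeologicalSpace X] : DiffeologicalSpace (Omega1 X) where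
  plots m := {w | ∀ (n : ℕ) (p : {p : Euc n → X // IsPlot p}),
    ContDiff ℝ ∞ (fun z : Euc m × Euc n => (w z.1).1 n p z.2)}
  constant_plots η := fun n p => (η.2.1 n p).comp contDiff_snd
  plot_reparam hw hf := fun n p =>
    (hw n p).comp ((hf.comp contDiff_fst).prodMk contDiff_snd)
  locality {m w} h := fun n p => contDiff_iff_contDiffAt.2 fun z => by
    obtain ⟨u, hu, hz, hw⟩ := h z.1
    obtain ⟨ε, hε, hεu⟩ := Metric.isOpen_iff.mp hu z.1 hz
    let B := OpenPartialHomeomorph.univBall z.1 ε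
    have hBt : B.target = Metric.ball z.1 ε := OpenPartialHomeomorph.univBall_target z.1 hε
    have hB : ContDiff ℝ ∞ B := OpenPartialHomeomorph.contDiff_univBall
    have hBs : ContDiffOn ℝ ∞ B.symm (Metric.ball z.1 ε) :=
      OpenPartialHomeomorph.contDiffOn_univBall_symm
    have hBu : ∀ t, B t ∈ u := fun t => hεu (hBt ▸ B.map_source (by simp [B]))
    have h1 := hw hBu hB n p
    have hz1 : Metric.ball z.1 ε ∈ nhds z.1 := Metric.ball_mem_nhds _ hε
    have h2 : ContDiffAt ℝ ∞ (fun y : Euc m × Euc n => (B.symm y.1, y.2)) z :=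
      ((hBs.contDiffAt hz1).comp z contDiffAt_fst).prodMk contDiffAt_snd
    refine (h1.contDiffAt.comp z h2).congr_of_eventuallyEq ?_
    filter_upwards [continuousAt_fst.preimage_mem_nhds hz1] with y hy
    have : B (B.symm y.1) = y.1 := B.right_inv (hBt ▸ hy)
    simp [this]

instance (X : Type*) [DiffeologicalSpace X] : DiffeologicalVectorSpace (Omega1 X) where
  smooth_add _ _ hp := fun k q => (hp.1 k q).add (hp.2 k q)
  smooth_smul _ _ hp := fun k q => (hp.1.contDiff.comp contDiff_fst).smul (hp.2 k q)

/-- `η` vanishes at `x`: `η_p(0) = 0` for each plot `p` with `p(0) = x`. -/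
def VanishesAt {X : Type*} [DiffeologicalSpace X] (η : Omega1 X) (x : X) : Prop :=
  ∀ (n : ℕ) (p : {p : Euc n → X // IsPlot p}), p.1 0 = x → η.1 n p 0 = 0

/-- The pullback of a `1`-form along a smooth map: `(h^* η)_p = η_{h ∘ p}`. -/
def pullback {X Y : Type*} [DiffeologicalSpace X] [DiffeologicalSpace Y]
    (h : X → Y) (hh : DSmooth h) (η : Omega1 Y) : Omega1 X :=
  ⟨fun n p => η.1 n ⟨h ∘ p.1, hh n p.1 p.2⟩,
    fun n _ => η.2.1 n _,
    fun m n p f hf u => η.2.2 m n ⟨h ∘ p.1, hh n p.1 p.2⟩ f hf u⟩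

/-- The product `f η` of a smooth function and a `1`-form: `(f η)_p(u) = f(p(u)) η_p(u)`. -/
def mulForm {X : Type*} [DiffeologicalSpace X] (f : CInf X) (η : Omega1 X) : Omega1 X :=
  ⟨fun n p u => f.1 (p.1 u) • η.1 n p u,
    fun n p => (f.2 n p.1 p.2).contDiff.smul (η.2.1 n p),
    fun m n p g hg u => by simp [η.2.2 m n p g hg u]⟩

/-- The differential `df` of a smooth function: `(df)_p = d(f ∘ p)`. -/
def differential {X : Type*} [DiffeologicalSpace X] (f : CInf X) : Omega1 X :=
  ⟨fun n p u => fderiv ℝ (fun t => f.1 (p.1 t)) u,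
    fun n p => (f.2 n p.1 p.2).contDiff.fderiv_right (by simp),
    fun m n p g hg u => by
      have h1 : DifferentiableAt ℝ (fun t => f.1 (p.1 t)) (g u) :=
        ((f.2 n p.1 p.2).contDiff.differentiable (by simp)) _
      have h2 : DifferentiableAt ℝ g u := (hg.differentiable (by simp)) _
      exact fderiv_comp u h1 h2⟩

/-! ## Vector pseudo-bundles

A family `F : B → Type*` of real vector spaces is viewed as the projection `(Σ b, F b) → B`. -/

section Bundles

variable {B : Type*} [DiffeologicalSpace B] (F : B → Type*)
  [∀ b, AddCommGroup (F b)] [∀ b, Module ℝ (F b)]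

/-- A diffeology on the total space makes it a diffeological vector pseudo-bundle: the projection,
the fibrewise addition on `E ×_B E`, the fibrewise scalar multiplication on `ℝ × E` and the zero
section are smooth. -/
structure IsVectorPseudoBundle (d : DiffeologicalSpace (Σ b, F b)) : Prop where
  smooth_proj : DSmooth (fun e : Σ b, F b => e.1)
  smooth_add : ∀ (n : ℕ) (b : Euc n → B) (v w : ∀ t, F (b t)),
    IsPlot (fun t => (⟨b t, v t⟩ : Σ b, F b)) → IsPlot (fun t => (⟨b t, w t⟩ : Σ b, F b)) →
      IsPlot (fun t => (⟨b t, v t + w t⟩ : Σ b, F b))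
  smooth_smul : DSmooth (fun z : ℝ × (Σ b, F b) => (⟨z.2.1, z.1 • z.2.2⟩ : Σ b, F b))
  smooth_zero : DSmooth (fun b => (⟨b, 0⟩ : Σ b, F b))

/-- Dvsification: the smallest diffeology that contains `d` and is a vector pseudo-bundle. -/
@[reducible]
def dvsification (d : DiffeologicalSpace (Σ b, F b)) : DiffeologicalSpace (Σ b, F b) :=
  sInf {d' | d ≤ d' ∧ IsVectorPseudoBundle F d'}

/-- The dvsification is indeed the least such diffeology. -/
theorem dvsification_isLeast (d : DiffeologicalSpace (Σ b, F b))
    (hd : DSmooth (fun e : Σ b, F b => e.1)) :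
    IsLeast {d' | d ≤ d' ∧ IsVectorPseudoBundle F d'} (dvsification F d) := by
  refine ⟨⟨le_sInf fun d' h => h.1, ?_⟩, fun d' h => sInf_le h⟩
  have hc : inducedDiffeology (fun e : Σ b, F b => e.1) ∈
      {d' | d ≤ d' ∧ IsVectorPseudoBundle F d'} :=
    ⟨DiffeologicalSpace.le_iff'.2 hd,
      @IsVectorPseudoBundle.mk _ _ _ _ _ (inducedDiffeology fun e : Σ b, F b => e.1)
        (fun _ _ h => h) (fun _ _ _ _ h _ => h) (fun _ _ h => h.2) (fun _ _ h => h)⟩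
  exact @IsVectorPseudoBundle.mk _ _ _ _ _ (dvsification F d)
    (fun n p h => DiffeologicalSpace.isPlot_sInf_iff.1 h _ hc)
    (fun n b v w hv hw => DiffeologicalSpace.isPlot_sInf_iff.2 fun d' h' =>
      h'.2.smooth_add n b v w (DiffeologicalSpace.isPlot_sInf_iff.1 hv d' h')
        (DiffeologicalSpace.isPlot_sInf_iff.1 hw d' h'))
    (fun n p h => DiffeologicalSpace.isPlot_sInf_iff.2 fun d' h' =>
      @IsVectorPseudoBundle.smooth_smul _ _ _ _ _ d' h'.2 n p
        ⟨h.1, DiffeologicalSpace.isPlot_sInf_iff.1 h.2 d' h'⟩)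
    (fun n p h => DiffeologicalSpace.isPlot_sInf_iff.2 fun d' h' =>
      @IsVectorPseudoBundle.smooth_zero _ _ _ _ _ d' h'.2 n p h)

variable [DiffeologicalSpace (Σ b, F b)]

/-- The set of (smooth) sections of `(Σ b, F b) → B`. -/
def sections : Set (∀ b, F b) := {s | DSmooth (fun b => (⟨b, s b⟩ : Σ b, F b))}

/-- The fibre over `b` of the dual bundle: the linear maps `F b → ℝ` that are smooth for the
subset diffeology of `F b` in the total space. -/
def DualFiber (b : B) : Submodule ℝ (Module.Dual ℝ (F b)) where
  carrier := {l | @DSmooth _ _ (inducedDiffeology (Sigma.mk b : F b → Σ b, F b)) _ l}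
  add_mem' hf hg n p hp := ((hf n p hp).contDiff.add (hg n p hp).contDiff).isPlot
  zero_mem' := by
    intro n p hp
    exact isPlot_const
  smul_mem' c f hf n p hp := ((hf n p hp).contDiff.const_smul c).isPlot

/-- The diffeology of the dual bundle: `p : U → E*` is a plot iff its projection to `B` is a plot
and `U ×_B E → ℝ`, `(u, e) ↦ p(u)(e)`, is smooth. A plot of `U ×_B E` is written as a pair of a
smooth `f` into `U` and a plot `t ↦ v t` of `E` with `v t` in the fibre over the image of `f t`. -/
instance instDual : DiffeologicalSpace (Σ b, DualFiber F b) where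
  plots n := {p | IsPlot (fun t => (p t).1) ∧
    ∀ (m : ℕ) (f : Euc m → Euc n) (_ : ContDiff ℝ ∞ f) (v : ∀ t, F (p (f t)).1),
      IsPlot (fun t => (⟨(p (f t)).1, v t⟩ : Σ b, F b)) →
        IsPlot (fun t => (p (f t)).2.1 (v t))}
  constant_plots l := ⟨isPlot_const, fun m f hf v hv => l.2.2 m v hv⟩
  plot_reparam hp hf := ⟨isPlot_reparam hp.1 hf, fun m g hg v hv => hp.2 m _ (hf.comp hg) v hv⟩
  locality {n p} h := by
    refine ⟨isPlot_of_local fun x => ?_, fun m f hf v hv => isPlot_of_local fun x => ?_⟩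
    · obtain ⟨u, hu, hx, h'⟩ := h x
      exact ⟨u, hu, hx, fun m f h1 h2 => (h' h1 h2).1⟩
    · obtain ⟨u, hu, hx, h'⟩ := h (f x)
      refine ⟨f ⁻¹' u, hu.preimage hf.continuous, hx, fun k g hgu hg => ?_⟩
      exact (h' (f := f ∘ g) hgu (hf.comp hg)).2 k id contDiff_id (fun t => v (g t))
        (isPlot_reparam hv hg)

end Bundles

/-! ## The internal tangent bundle -/

section Tangent

variable {X : Type*} [DiffeologicalSpace X]

/-- A plot `ℝⁿ → X` with a point of `ℝⁿ` that is sent to `x`. -/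
structure PlotAt (x : X) where
  n : ℕ
  p : Euc n → X
  isPlot : IsPlot p
  u : Euc n
  map_u : p u = x

open Classical in
/-- The inclusion of `T_u ℝⁿ = ℝⁿ` in the direct sum over all plots through `x`. -/
def tangentIncl {x : X} (P : PlotAt x) :
    Euc P.n →ₗ[ℝ] DirectSum (PlotAt x) (fun P => Euc P.n) :=
  DirectSum.lof ℝ (PlotAt x) (fun P => Euc P.n) P

/-- The relations `f_* v = v` for a smooth map `f` from the plot `p ∘ f` to the plot `p`. -/
def tangentRel (x : X) : Submodule ℝ (DirectSum (PlotAt x) (fun P => Euc P.n)) :=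
  Submodule.span ℝ {z | ∃ (m n : ℕ) (p : Euc n → X) (hp : IsPlot p) (f : Euc m → Euc n)
    (hf : ContDiff ℝ ∞ f) (u : Euc m) (hu : p (f u) = x) (v : Euc m),
    z = tangentIncl ⟨n, p, hp, f u, hu⟩ (fderiv ℝ f u v)
      - tangentIncl ⟨m, p ∘ f, isPlot_reparam hp hf, u, hu⟩ v}

/-- The tangent space `T_x X`: the colimit of the vector spaces `T_u ℝⁿ` over the category of
plots `p : ℝⁿ → X` with a chosen point `u` over `x` (by translation, one may take `u = 0`). -/
abbrev TangentSp (x : X) : Type _ :=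
  DirectSum (PlotAt x) (fun P => Euc P.n) ⧸ tangentRel x

/-- The map `Tp : T ℝⁿ = ℝⁿ × ℝⁿ → T X` induced by a plot `p`. -/
def tangentMap {n : ℕ} (p : Euc n → X) (hp : IsPlot p) (z : Euc n × Euc n) :
    Σ x : X, TangentSp x :=
  ⟨p z.1, (tangentRel (p z.1)).mkQ (tangentIncl ⟨n, p, hp, z.1, rfl⟩ z.2)⟩

variable (X) in
/-- Hector's diffeology on `T X`, generated by the maps `Tp` (precomposed with smooth maps
`ℝᵐ → T ℝⁿ`). -/
@[reducible]
def hectorDiffeology : DiffeologicalSpace (Σ x : X, TangentSp x) :=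
  DiffeologicalSpace.generateFrom {q | ∃ (m n : ℕ) (p : Euc n → X) (hp : IsPlot p)
    (g : Euc m → Euc n × Euc n), ContDiff ℝ ∞ g ∧ q = ⟨m, tangentMap p hp ∘ g⟩}

/-- The diffeology of the internal tangent bundle `T^dvs X`. -/
instance instTangent : DiffeologicalSpace (Σ x : X, TangentSp x) :=
  dvsification (fun x : X => TangentSp x) (hectorDiffeology X)

/-- `T^dvs X` is a vector pseudo-bundle. -/
theorem isVectorPseudoBundle_tangent :
    IsVectorPseudoBundle (fun x : X => TangentSp x) instTangent := by
  have h : hectorDiffeology X ≤ inducedDiffeology (fun e : Σ x : X, TangentSp x => e.1) := by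
    refine DiffeologicalSpace.generateFrom_le_iff.2 ?_
    rintro k q ⟨m, n, p, hp, g, hg, h⟩
    obtain ⟨rfl, h⟩ := Sigma.mk.inj h
    obtain rfl := eq_of_heq h
    exact isPlot_reparam hp (contDiff_fst.comp hg)
  exact (dvsification_isLeast (fun x : X => TangentSp x) (hectorDiffeology X)
    (DiffeologicalSpace.le_iff'.1 h)).1.2

end Tangent

/-! ## The axes with the gluing diffeology -/

/-- The union of the two axes in `ℝ²`. -/
def Xg : Type := {z : Euc 2 // z 1 = 0 ∨ z 0 = 0}

/-- The inclusion of the `x`-axis. -/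
def inclX (t : ℝ) : Xg := ⟨!₂[t, 0], Or.inl (by simp)⟩

/-- The inclusion of the `y`-axis. -/
def inclY (t : ℝ) : Xg := ⟨!₂[0, t], Or.inr (by simp)⟩

/-- The origin. -/
def origin : Xg := inclX 0

/-- The gluing diffeology: the quotient diffeology of `ℝ ⊔ ℝ → X_g`, that is, the smallest
diffeology for which the inclusions of the two axes are smooth. -/
instance instXg : DiffeologicalSpace Xg :=
  sInf {d | @DSmooth ℝ Xg _ d inclX ∧ @DSmooth ℝ Xg _ d inclY}

/-- The inclusion `X_g → ℝ²`. -/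
def inclPlane (z : Xg) : Euc 2 := z.1

/-- The universal property of the gluing. -/
theorem dSmooth_Xg_iff {Y : Type*} [DiffeologicalSpace Y] (f : Xg → Y) :
    DSmooth f ↔ DSmooth (f ∘ inclX) ∧ DSmooth (f ∘ inclY) := by
  have hX : DSmooth inclX := fun n p hp =>
    DiffeologicalSpace.isPlot_sInf_iff.2 fun d hd => hd.1 n p hp
  have hY : DSmooth inclY := fun n p hp =>
    DiffeologicalSpace.isPlot_sInf_iff.2 fun d hd => hd.2 n p hp
  refine ⟨fun hf => ⟨hf.comp hX, hf.comp hY⟩, fun h n p hp => ?_⟩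
  exact DiffeologicalSpace.isPlot_sInf_iff.1 hp (inducedDiffeology f) ⟨h.1, h.2⟩

theorem dSmooth_inclPlane : DSmooth inclPlane := by
  refine (dSmooth_Xg_iff _).2 ⟨ContDiff.dSmooth ?_, ContDiff.dSmooth ?_⟩ <;>
  · refine contDiff_euclidean.2 fun i => ?_
    fin_cases i <;> simp [inclPlane, inclX, inclY, contDiff_const]
    exact contDiff_id

/-- The `i`-th coordinate function on `ℝ²`. -/
def coordPlane (i : Fin 2) : CInf (Euc 2) :=
  ⟨fun z => z i, ContDiff.dSmooth (by fun_prop)⟩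

/-- The coordinate functions `x` (`i = 0`) and `y` (`i = 1`) on `X_g` are smooth. -/
theorem dSmooth_coord (i : Fin 2) : DSmooth (fun z : Xg => inclPlane z i) :=
  (coordPlane i).2.comp dSmooth_inclPlane

/-- The `1`-form `dx` on `X_g`, the pullback of `dx` on `ℝ²`. -/
def dx : Omega1 Xg := pullback inclPlane dSmooth_inclPlane (differential (coordPlane 0))

/-- The `1`-form `dy` on `X_g`, the pullback of `dy` on `ℝ²`. -/
def dy : Omega1 Xg := pullback inclPlane dSmooth_inclPlane (differential (coordPlane 1))

/-- The `1`-form `f(x) dx + g(y) dy` on `X_g`. -/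
def axesForm (f g : CInf ℝ) : Omega1 Xg :=
  mulForm (CInf.comp f (fun z : Xg => inclPlane z 0) (dSmooth_coord 0)) dx +
    mulForm (CInf.comp g (fun z : Xg => inclPlane z 1) (dSmooth_coord 1)) dy

end AxesForms

end

open AxesForms

noncomputable section

namespace AxesForms

open Topology Filter

/-! ## Plots of the axes -/

/-! Everything rests on the fact that a plot of `X_g` locally stays on one axis. The maps with this
property form a diffeology making both inclusions smooth, so the gluing diffeology, being the
smallest such, lies inside it (`IsPlot.exists_axis`). Composed with a chart whose derivative is
onto, a plot therefore factors smoothly through one axis (`IsPlot.exists_factor`).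

For forms, compatibility with pullback along this factorisation shows that a form is determined by
its values on the two axis plots (`form_ext_of_axes`), that is, by two coefficient functions.
Reading them off inverts `axesForm`, and both directions are smooth in parameters. No condition ties
the two coefficients together at the origin.

For the bundles, a form pairs smoothly with internal tangent vectors (`dSmooth_evalForm`), so `dx`
is a section of the dual, with value 1 on the unit vector of the `x`-axis at the origin. The same
factorisation shows that the two axis vectors span the tangent space there, with `dx` and `dy` as
coordinates (`tangent_origin_eq`). Off the origin, `dy` is zero on tangent vectors along the
`x`-axis; paired with a vector field it is continuous along that axis, hence zero at the origin too.
By symmetry both coordinates of a vector field vanish there. -/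

/-- Every neighbourhood of a point of `ℝⁿ` contains the image of a smooth map `ℝⁿ → ℝⁿ` that is
a submersion at `0`, which is sent to the given point, and locally surjective there. -/
theorem exists_chart {n : ℕ} {u : Euc n} {s : Set (Euc n)} (hs : s ∈ 𝓝 u) :
    ∃ B : Euc n → Euc n, ContDiff ℝ ∞ B ∧ B 0 = u ∧ (∀ t, B t ∈ s) ∧
      Function.Surjective (fderiv ℝ B 0) ∧ map B (𝓝 0) = 𝓝 u := by
  obtain ⟨ε, hε, hεs⟩ := Metric.mem_nhds_iff.mp hs
  let B := OpenPartialHomeomorph.univBall u ε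
  have hBt : B.target = Metric.ball u ε := OpenPartialHomeomorph.univBall_target u hε
  have hB : ContDiff ℝ ∞ B := OpenPartialHomeomorph.contDiff_univBall
  have hBs : ContDiffOn ℝ ∞ B.symm (Metric.ball u ε) :=
    OpenPartialHomeomorph.contDiffOn_univBall_symm
  have hB0 : B 0 = u := OpenPartialHomeomorph.univBall_apply_zero u ε
  have hBu : B.symm u = 0 := OpenPartialHomeomorph.univBall_symm_apply_center u ε
  have hball : Metric.ball u ε ∈ 𝓝 u := Metric.ball_mem_nhds _ hε
  refine ⟨B, hB, hB0, fun t => hεs (hBt ▸ B.map_source (by simp [B])), fun v => ?_, ?_⟩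
  · have h1 : HasFDerivAt B (fderiv ℝ B 0) (B.symm u) := by
      rw [hBu]; exact (hB.differentiable (by simp) 0).hasFDerivAt
    have h2 : HasFDerivAt B.symm (fderiv ℝ B.symm u) u :=
      ((hBs.contDiffAt hball).differentiableAt (by simp)).hasFDerivAt
    -- By the chain rule the derivative of `B.symm` at `u` is a right inverse of that of `B` at `0`,
    -- which gives surjectivity.
    have h3 : HasFDerivAt (B ∘ B.symm) (ContinuousLinearMap.id ℝ (Euc n)) u := by
      refine (hasFDerivAt_id u).congr_of_eventuallyEq ?_
      filter_upwards [hball] with y hy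
      exact B.right_inv (hBt ▸ hy)
    exact ⟨fderiv ℝ B.symm u v, congrArg (fun L => L v) ((h1.comp u h2).unique h3)⟩
  · have := B.map_nhds_eq (x := 0) (by simp [B])
    rwa [hB0] at this

/-- The maps to the axes that locally stay on one of the two axes. -/
@[reducible]
def axisDiffeology : DiffeologicalSpace Xg where
  plots n := {p | ∀ u, ∃ i : Fin 2, ∀ᶠ t in 𝓝 u, ∀ j ≠ i, inclPlane (p t) j = 0}
  constant_plots {n} z u := by
    rcases z.2 with h | h
    · refine ⟨0, Eventually.of_forall fun t j hj => ?_⟩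
      obtain rfl : j = 1 := by omega
      exact h
    · refine ⟨1, Eventually.of_forall fun t j hj => ?_⟩
      obtain rfl : j = 0 := by omega
      exact h
  plot_reparam hp hf u := by
    obtain ⟨i, hi⟩ := hp _
    exact ⟨i, hf.continuous.continuousAt.eventually hi⟩
  locality {n p} h u := by
    obtain ⟨s, hs, hu, h'⟩ := h u
    obtain ⟨B, hB, hB0, hBs, -, hBm⟩ := exists_chart (hs.mem_nhds hu)
    obtain ⟨i, hi⟩ := h' hBs hB 0
    refine ⟨i, ?_⟩
    -- The hypothesis speaks of `p ∘ B` near `0`; local surjectivity of `B` turns this into a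
    -- statement about `p` near `u`.
    rw [← hBm]
    exact hi

/-- A plot of `X_g` locally stays on one of the two axes. -/
theorem IsPlot.exists_axis {n : ℕ} {p : Euc n → Xg} (hp : IsPlot p) (u : Euc n) :
    ∃ i : Fin 2, ∀ᶠ t in 𝓝 u, ∀ j ≠ i, inclPlane (p t) j = 0 := by
  refine DiffeologicalSpace.isPlot_sInf_iff.1 hp axisDiffeology ⟨?_, ?_⟩ u
  · refine fun n p _ u => ⟨0, Eventually.of_forall fun t j hj => ?_⟩
    obtain rfl : j = 1 := by omega
    simp [inclPlane, inclX]
  · refine fun n p _ u => ⟨1, Eventually.of_forall fun t j hj => ?_⟩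
    obtain rfl : j = 0 := by omega
    simp [inclPlane, inclY]

theorem IsPlot.contDiff_coord {n : ℕ} {p : Euc n → Xg} (hp : IsPlot p) (i : Fin 2) :
    ContDiff ℝ ∞ (fun t => inclPlane (p t) i) :=
  (dSmooth_coord i n p hp).contDiff

/-- The `i`-th axis as a map `ℝ¹ → X_g`. -/
def axisMap (i : Fin 2) (t : Euc 1) : Xg :=
  if i = 0 then inclX (t 0) else inclY (t 0)

theorem isPlot_axisMap (i : Fin 2) : IsPlot (axisMap i) := by
  have h0 : IsPlot (fun t : Euc 1 => t 0) := ContDiff.isPlot (by fun_prop)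
  -- The universal property applied to the identity yields smoothness of both inclusions.
  have h := (dSmooth_Xg_iff (id : Xg → Xg)).1 dSmooth_id
  unfold axisMap
  split_ifs
  · exact h.1 _ _ h0
  · exact h.2 _ _ h0

/-- The `i`-th axis as a plot. -/
def axisPlot (i : Fin 2) : {p : Euc 1 → Xg // IsPlot p} := ⟨axisMap i, isPlot_axisMap i⟩

theorem inclPlane_axisMap_self (i : Fin 2) (t : Euc 1) : inclPlane (axisMap i t) i = t 0 := by
  fin_cases i <;> simp [axisMap, inclPlane, inclX, inclY]

theorem inclPlane_axisMap_of_ne {i j : Fin 2} (h : j ≠ i) (t : Euc 1) :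
    inclPlane (axisMap i t) j = 0 := by
  fin_cases i <;> fin_cases j <;> simp [axisMap, inclPlane, inclX, inclY] at h ⊢

theorem inclPlane_injective : Function.Injective inclPlane := Subtype.val_injective

/-- A vector of `ℝ¹` from its coordinate. -/
def line (t : ℝ) : Euc 1 := EuclideanSpace.single 0 t

@[simp] theorem line_apply (t : ℝ) : line t 0 = t := by simp [line]

theorem contDiff_line : ContDiff ℝ ∞ line := by
  refine contDiff_euclidean.2 fun i => ?_
  obtain rfl : i = 0 := Subsingleton.elim _ _
  simpa using contDiff_fun_id

theorem eq_smul_line (v : Euc 1) : v = v 0 • line 1 := by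
  ext i
  obtain rfl : i = 0 := Subsingleton.elim _ _
  simp

theorem eq_line (v : Euc 1) : v = line (v 0) := by
  ext i
  obtain rfl : i = 0 := Subsingleton.elim _ _
  simp

theorem eq_axisMap_of_coord {z : Xg} {i : Fin 2} (h : ∀ j ≠ i, inclPlane z j = 0) :
    z = axisMap i (line (inclPlane z i)) := by
  refine inclPlane_injective (PiLp.ext fun j => ?_)
  by_cases hj : j = i
  · subst hj; rw [inclPlane_axisMap_self, line_apply]
  · rw [h j hj, inclPlane_axisMap_of_ne hj]

/-- After reparametrisation near a point, a plot of `X_g` factors smoothly through an axis. -/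
theorem IsPlot.exists_factor {n : ℕ} {p : Euc n → Xg} (hp : IsPlot p) (u : Euc n) :
    ∃ (i : Fin 2) (B : Euc n → Euc n) (h : Euc n → Euc 1), ContDiff ℝ ∞ B ∧ ContDiff ℝ ∞ h ∧
      B 0 = u ∧ Function.Surjective (fderiv ℝ B 0) ∧ p ∘ B = axisMap i ∘ h := by
  obtain ⟨i, hi⟩ := IsPlot.exists_axis hp u
  obtain ⟨B, hB, hB0, hBs, hsurj, -⟩ := exists_chart hi
  exact ⟨i, B, fun t => line (inclPlane (p (B t)) i), hB,
    contDiff_line.comp ((IsPlot.contDiff_coord hp i).comp hB), hB0, hsurj,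
    funext fun t => eq_axisMap_of_coord (hBs t)⟩

/-! ## Differential forms on the axes -/

/-- A `1`-form on `X_g` is determined by its values on the two axes. -/
theorem form_ext_of_axes {η ζ : Omega1 Xg}
    (h : ∀ i, η.1 1 (axisPlot i) = ζ.1 1 (axisPlot i)) : η = ζ := by
  refine Subtype.ext (funext fun n => funext fun p => funext fun u => ?_)
  obtain ⟨i, B, k, hB, hk, rfl, hsurj, hpB⟩ := IsPlot.exists_factor p.2 u
  -- Both sides are the value of `θ` on the single plot `p ∘ B = axisMap i ∘ k`. As the derivative
  -- of `B` at `0` is onto, the left side determines `θ` at `p` and `B 0`.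
  have key : ∀ θ : Omega1 Xg, (θ.1 n p (B 0)).comp (fderiv ℝ B 0) =
      (θ.1 1 (axisPlot i) (k 0)).comp (fderiv ℝ k 0) := fun θ => by
    rw [← θ.2.2 n n p B hB 0, ← θ.2.2 n 1 (axisPlot i) k hk 0]
    have hq : (⟨p.1 ∘ B, isPlot_reparam p.2 hB⟩ : {p : Euc n → Xg // IsPlot p}) =
        ⟨(axisPlot i).1 ∘ k, isPlot_reparam (axisPlot i).2 hk⟩ := Subtype.ext hpB
    rw [hq]
  ext v
  obtain ⟨w, rfl⟩ := hsurj v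
  have := (key η).trans ((congrArg (fun L => (L (k 0)).comp (fderiv ℝ k 0)) (h i)).trans
    (key ζ).symm)
  exact congrArg (fun L => L w) this

/-- The pullback of `dx` (`i = 0`) or `dy` (`i = 1`) to `X_g`. -/
def dCoord (i : Fin 2) : Omega1 Xg :=
  pullback inclPlane dSmooth_inclPlane (differential (coordPlane i))

theorem dCoord_apply (i : Fin 2) (n : ℕ) (p : {p : Euc n → Xg // IsPlot p}) (u : Euc n) :
    (dCoord i).1 n p u = fderiv ℝ (fun t => inclPlane (p.1 t) i) u := rfl

theorem dCoord_axisPlot_self (i : Fin 2) (t v : Euc 1) :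
    (dCoord i).1 1 (axisPlot i) t v = v 0 := by
  have : (fun t => inclPlane ((axisPlot i).1 t) i) = EuclideanSpace.proj (𝕜 := ℝ) (0 : Fin 1) :=
    funext fun t => inclPlane_axisMap_self i t
  rw [dCoord_apply, this, ContinuousLinearMap.fderiv]
  rfl

theorem dCoord_axisPlot_of_ne {i j : Fin 2} (h : j ≠ i) (t : Euc 1) :
    (dCoord j).1 1 (axisPlot i) t = 0 := by
  have : (fun t => inclPlane ((axisPlot i).1 t) j) = fun _ => (0 : ℝ) :=
    funext fun t => inclPlane_axisMap_of_ne h t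
  rw [dCoord_apply, this]
  simp

/-- The form `dx_j` is zero at points where another coordinate is nonzero. -/
theorem dCoord_eq_zero {i j : Fin 2} (h : j ≠ i) {n : ℕ} (p : {p : Euc n → Xg // IsPlot p})
    (u : Euc n) (hu : inclPlane (p.1 u) i ≠ 0) : (dCoord j).1 n p u = 0 := by
  obtain ⟨k, hk⟩ := IsPlot.exists_axis p.2 u
  -- The `i`-th coordinate is nonzero at `u`, so the axis on which the plot stays can only be the
  -- `i`-th; there the `j`-th coordinate is locally zero.
  obtain rfl : i = k := by
    by_contra hik
    exact hu (hk.self_of_nhds i hik)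
  rw [dCoord_apply, Filter.EventuallyEq.fderiv_eq (f := fun _ => (0 : ℝ))]
  · simp
  · filter_upwards [hk] with t ht using ht j h

/-- The coefficient of a form along the `i`-th axis. -/
def axisCoeff (i : Fin 2) (η : Omega1 Xg) : CInf ℝ :=
  ⟨fun t => η.1 1 (axisPlot i) (line t) (line 1),
    (((η.2.1 1 (axisPlot i)).comp contDiff_line).clm_apply contDiff_const).dSmooth⟩

theorem axesForm_apply (f g : CInf ℝ) (n : ℕ) (p : {p : Euc n → Xg // IsPlot p}) (u : Euc n) :
    (axesForm f g).1 n p u = f.1 (inclPlane (p.1 u) 0) • (dCoord 0).1 n p u +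
      g.1 (inclPlane (p.1 u) 1) • (dCoord 1).1 n p u := rfl

theorem axisCoeff_zero_axesForm (f g : CInf ℝ) : axisCoeff 0 (axesForm f g) = f := by
  refine Subtype.ext (funext fun t => ?_)
  change (axesForm f g).1 1 (axisPlot 0) (line t) (line 1) = _
  have h : inclPlane ((axisPlot 0).1 (line t)) 0 = t := by
    rw [axisPlot, inclPlane_axisMap_self, line_apply]
  rw [axesForm_apply, dCoord_axisPlot_of_ne (by decide : (1 : Fin 2) ≠ 0), h]
  simp [dCoord_axisPlot_self]

theorem axisCoeff_one_axesForm (f g : CInf ℝ) : axisCoeff 1 (axesForm f g) = g := by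
  refine Subtype.ext (funext fun t => ?_)
  change (axesForm f g).1 1 (axisPlot 1) (line t) (line 1) = _
  have h : inclPlane ((axisPlot 1).1 (line t)) 1 = t := by
    rw [axisPlot, inclPlane_axisMap_self, line_apply]
  rw [axesForm_apply, dCoord_axisPlot_of_ne (by decide : (0 : Fin 2) ≠ 1), h]
  simp [dCoord_axisPlot_self]

theorem form_ext_of_axisCoeff {η ζ : Omega1 Xg} (h : ∀ i, axisCoeff i η = axisCoeff i ζ) :
    η = ζ := by
  refine form_ext_of_axes fun i => funext fun t => ContinuousLinearMap.ext fun v => ?_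
  rw [eq_smul_line v, map_smul, map_smul, eq_line t]
  exact congrArg (fun r => v 0 • r) (congrFun (congrArg Subtype.val (h i)) (t 0))

/-- Since the two coefficients determine a form, it suffices that both sides have the same ones,
which is the left-inverse computation applied to the coefficients of `η`. -/
theorem axesForm_axisCoeff (η : Omega1 Xg) :
    axesForm (axisCoeff 0 η) (axisCoeff 1 η) = η := by
  refine form_ext_of_axisCoeff (Fin.forall_fin_two.2 ⟨?_, ?_⟩)
  · exact axisCoeff_zero_axesForm _ _
  · exact axisCoeff_one_axesForm _ _

/-- `(f, g) ↦ f(x) dx + g(y) dy` as a linear isomorphism. -/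
def axesFormEquiv : (CInf ℝ × CInf ℝ) ≃ₗ[ℝ] Omega1 Xg where
  toFun z := axesForm z.1 z.2
  map_add' a b := by
    refine Subtype.ext (funext fun n => funext fun p => funext fun u => ?_)
    change (axesForm (a.1 + b.1) (a.2 + b.2)).1 n p u =
      (axesForm a.1 a.2).1 n p u + (axesForm b.1 b.2).1 n p u
    simp only [axesForm_apply, AddMemClass.coe_add, Pi.add_apply, add_smul]
    abel
  map_smul' c a := by
    refine Subtype.ext (funext fun n => funext fun p => funext fun u => ?_)
    change (axesForm (c • a.1) (c • a.2)).1 n p u = c • (axesForm a.1 a.2).1 n p u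
    simp only [axesForm_apply, smul_add, smul_smul]
    rfl
  invFun η := (axisCoeff 0 η, axisCoeff 1 η)
  left_inv z := Prod.ext (axisCoeff_zero_axesForm _ _) (axisCoeff_one_axesForm _ _)
  right_inv η := axesForm_axisCoeff η

/-- Plots of `C^∞(ℝ, ℝ)` are smooth functions of two variables, on any finite-dimensional
parameter space. -/
theorem contDiff_uncurry_of_isPlot {m : ℕ} {w : Euc m → CInf ℝ} (hw : IsPlot w) {n : ℕ}
    {k : Euc n → ℝ} (hk : ContDiff ℝ ∞ k) :
    ContDiff ℝ ∞ (fun z : Euc m × Euc n => (w z.1).1 (k z.2)) := by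
  -- Plots are only indexed by the spaces `Euc k`, so the product of parameter spaces is first
  -- identified with one of them.
  have e : Euc (m + n) ≃L[ℝ] Euc m × Euc n :=
    ContinuousLinearEquiv.ofFinrankEq (by simp)
  have h : ContDiff ℝ ∞ (fun t : Euc (m + n) => (w (e t).1).1 (k (e t).2)) :=
    (hw (m + n) (fun t => ((e t).1, k (e t).2))
      ⟨(contDiff_fst.comp e.contDiff).isPlot,
        (hk.comp (contDiff_snd.comp e.contDiff)).isPlot⟩).contDiff
  simpa [Function.comp_def] using h.comp e.symm.contDiff

theorem dSmooth_axesFormEquiv : DSmooth axesFormEquiv := by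
  intro m w hw n p
  exact ((contDiff_uncurry_of_isPlot hw.1 (IsPlot.contDiff_coord p.2 0)).smul
    (((dCoord 0).2.1 n p).comp contDiff_snd)).add
    ((contDiff_uncurry_of_isPlot hw.2 (IsPlot.contDiff_coord p.2 1)).smul
      (((dCoord 1).2.1 n p).comp contDiff_snd))

theorem dSmooth_axisCoeff (i : Fin 2) : DSmooth (axisCoeff i) := by
  intro m w hw n p hp
  have h : ContDiff ℝ ∞ (fun t => (w (p t).1).1 1 (axisPlot i) (line (p t).2) (line 1)) :=
    ((hw 1 (axisPlot i)).comp (hp.1.contDiff.prodMk (contDiff_line.comp hp.2.contDiff))).clm_apply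
      contDiff_const
  exact h.isPlot

/-- The isomorphism `C^∞(ℝ, ℝ) × C^∞(ℝ, ℝ) ≅ Ω¹(X_g)` of diffeological vector spaces. -/
def axesFormDVSEquiv : DVSEquiv (CInf ℝ × CInf ℝ) (Omega1 Xg) where
  toLinearEquiv := axesFormEquiv
  smooth_toFun := dSmooth_axesFormEquiv
  smooth_invFun m w hw := ⟨dSmooth_axisCoeff 0 m w hw, dSmooth_axisCoeff 1 m w hw⟩

/-! ## The pairing of forms with tangent vectors -/

section Pairing

variable {X : Type*} [DiffeologicalSpace X]

open Classical in
/-- The pairing of a form with formal sums of tangent vectors. -/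
def preEval (η : Omega1 X) (x : X) : DirectSum (PlotAt x) (fun P => Euc P.n) →ₗ[ℝ] ℝ :=
  DirectSum.toModule ℝ (PlotAt x) ℝ fun P => (η.1 P.n ⟨P.p, P.isPlot⟩ P.u).toLinearMap

theorem preEval_tangentIncl (η : Omega1 X) {x : X} (P : PlotAt x) (v : Euc P.n) :
    preEval η x (tangentIncl P v) = η.1 P.n ⟨P.p, P.isPlot⟩ P.u v := by
  simp [preEval, tangentIncl]

/-- The pairing of a form with the tangent vectors at a point. -/
def evalForm (η : Omega1 X) (x : X) : TangentSp x →ₗ[ℝ] ℝ :=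
  (tangentRel x).liftQ (preEval η x) <| by
    refine Submodule.span_le.2 ?_
    rintro z ⟨m, n, p, hp, f, hf, u, hu, v, rfl⟩
    have := congrArg (fun L => L v) (η.2.2 m n ⟨p, hp⟩ f hf u)
    rw [SetLike.mem_coe, LinearMap.mem_ker, map_sub, sub_eq_zero]
    exact (preEval_tangentIncl η ⟨n, p, hp, f u, hu⟩ _).trans
      (this.symm.trans (preEval_tangentIncl η ⟨m, p ∘ f, isPlot_reparam hp hf, u, hu⟩ v).symm)

/-- The class of the vector `v` at the marked point of a plot. -/
def tangentClass {x : X} (P : PlotAt x) : Euc P.n →ₗ[ℝ] TangentSp x :=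
  (tangentRel x).mkQ ∘ₗ tangentIncl P

@[simp]
theorem evalForm_tangentClass (η : Omega1 X) {x : X} (P : PlotAt x) (v : Euc P.n) :
    evalForm η x (tangentClass P v) = η.1 P.n ⟨P.p, P.isPlot⟩ P.u v :=
  preEval_tangentIncl η P v

theorem tangentSp_linearMap_ext {x : X} {M : Type*} [AddCommGroup M] [Module ℝ M]
    {f g : TangentSp x →ₗ[ℝ] M}
    (h : ∀ (P : PlotAt x) (v : Euc P.n), f (tangentClass P v) = g (tangentClass P v)) :
    f = g := by
  classical
  refine Submodule.linearMap_qext _ (DirectSum.linearMap_ext _ fun P => LinearMap.ext fun v => ?_)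
  have := h P v
  simp only [tangentClass, tangentIncl] at this
  convert this <;> simp

/-- This is the defining relation of the colimit, with the composite plot and the image point as
variables up to equality, so that one plot can be factored in two ways. -/
theorem tangentClass_comp {x : X} {m n : ℕ} {p : Euc n → X} (hp : IsPlot p) {f : Euc m → Euc n}
    (hf : ContDiff ℝ ∞ f) {q : Euc m → X} (hq : IsPlot q) (hqf : p ∘ f = q) {u : Euc m}
    {u' : Euc n} (hu' : f u = u') (hx : p u' = x) (hx' : q u = x) (v : Euc m) :
    tangentClass ⟨n, p, hp, u', hx⟩ (fderiv ℝ f u v) = tangentClass ⟨m, q, hq, u, hx'⟩ v := by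
  subst hqf hu'
  exact (Submodule.Quotient.eq _).2
    (Submodule.subset_span ⟨m, n, p, hp, f, hf, u, hx, v, rfl⟩)

/-- The pairing with a form is smooth on the internal tangent bundle. -/
theorem dSmooth_evalForm (η : Omega1 X) :
    DSmooth (fun e : Σ x : X, TangentSp x => evalForm η e.1 e.2) := by
  -- The coarsest diffeology making the projection and the pairing smooth. It is a vector
  -- pseudo-bundle because the pairing is fibrewise linear, and it contains the generating plots
  -- because `η` is smooth on each plot; so it contains the dvsification.
  let d : DiffeologicalSpace (Σ x : X, TangentSp x) :=
    inducedDiffeology (fun e : Σ x : X, TangentSp x => (e.1, evalForm η e.1 e.2))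
  have hb : @IsVectorPseudoBundle X _ (fun x => TangentSp x) _ _ d := by
    refine @IsVectorPseudoBundle.mk _ _ _ _ _ d (fun n p hp => hp.1) ?_ ?_ ?_
    · intro n b v w hv hw
      refine ⟨hv.1, ?_⟩
      have := (hv.2.contDiff.add hw.2.contDiff).isPlot
      refine cast (congrArg IsPlot (funext fun t => ?_)) this
      exact (map_add _ _ _).symm
    · intro n p hp
      refine ⟨hp.2.1, ?_⟩
      have := (hp.1.contDiff.mul hp.2.2.contDiff).isPlot
      refine cast (congrArg IsPlot (funext fun t => ?_)) this
      exact (map_smul (evalForm η (p t).2.1) (p t).1 (p t).2.2).symm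
    · intro n p hp
      refine ⟨hp, ?_⟩
      refine cast (congrArg IsPlot (funext fun t => ?_)) (isPlot_const (x := (0 : ℝ)))
      exact (map_zero _).symm
  have hd : hectorDiffeology X ≤ d := by
    refine DiffeologicalSpace.generateFrom_le_iff.2 ?_
    rintro k q ⟨m, n, p, hp, g, hg, h⟩
    obtain ⟨rfl, h⟩ := Sigma.mk.inj h
    obtain rfl := eq_of_heq h
    refine ⟨isPlot_reparam hp (contDiff_fst.comp hg), ?_⟩
    have : ContDiff ℝ ∞ (fun t => η.1 n ⟨p, hp⟩ (g t).1 (g t).2) :=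
      ((η.2.1 n ⟨p, hp⟩).comp (contDiff_fst.comp hg)).clm_apply (contDiff_snd.comp hg)
    refine cast (congrArg IsPlot (funext fun t => ?_)) this.isPlot
    exact (evalForm_tangentClass η ⟨n, p, hp, (g t).1, rfl⟩ (g t).2).symm
  intro n p hp
  exact (DiffeologicalSpace.isPlot_sInf_iff.1 hp d ⟨hd, hb⟩).2

/-- A form as a section of the dual of the internal tangent bundle. -/
def dualSection (η : Omega1 X) (x : X) : DualFiber (fun x : X => TangentSp x) x :=
  ⟨evalForm η x, fun n p hp => dSmooth_evalForm η n (fun t => ⟨x, p t⟩) hp⟩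

theorem dualSection_mem_sections (η : Omega1 X) :
    dualSection η ∈ sections (fun x : X => DualFiber (fun x : X => TangentSp x) x) :=
  fun _ _ hp => ⟨hp, fun m _ _ v hv => dSmooth_evalForm η m (fun t => ⟨_, v t⟩) hv⟩

end Pairing

/-! ## Tangent vectors of the axes -/

/-- Needed to match marked points: a factorisation through an axis at the origin must land at the
parameter `0` used in `axisVector`. -/
theorem axisMap_eq_origin {i : Fin 2} {t : Euc 1} (h : axisMap i t = origin) : t = 0 := by
  have h1 := inclPlane_axisMap_self i t
  rw [h] at h1
  rw [eq_line t, ← h1]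
  fin_cases i <;> ext j <;> simp [origin, inclPlane, inclX, line]

theorem axisMap_zero (i : Fin 2) : axisMap i 0 = origin := by
  fin_cases i <;> refine Subtype.ext (PiLp.ext fun j => ?_) <;>
    fin_cases j <;> simp [axisMap, origin, inclX, inclY]

/-- The unit tangent vector of the `i`-th axis at the origin. -/
def axisVector (i : Fin 2) : TangentSp origin :=
  tangentClass ⟨1, axisMap i, isPlot_axisMap i, 0, axisMap_zero i⟩ (line 1)

theorem evalForm_axisVector_self (i : Fin 2) :
    evalForm (dCoord i) origin (axisVector i) = 1 := by
  rw [axisVector, evalForm_tangentClass]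
  exact (dCoord_axisPlot_self i 0 (line 1)).trans (line_apply 1)

theorem evalForm_axisVector_of_ne {i j : Fin 2} (h : j ≠ i) :
    evalForm (dCoord j) origin (axisVector i) = 0 := by
  rw [axisVector, evalForm_tangentClass]
  exact congrArg (fun L => L (line 1)) (dCoord_axisPlot_of_ne h 0)

/-- At the origin, the vectors of a plot are multiples of one of the two axis vectors. -/
theorem exists_tangentClass_eq_smul (P : PlotAt origin) (v : Euc P.n) :
    ∃ (i : Fin 2) (c : ℝ), tangentClass P v = c • axisVector i := by
  obtain ⟨n, p, hp, u, hu⟩ := P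
  obtain ⟨i, B, k, hB, hk, hB0, hsurj, hpB⟩ := IsPlot.exists_factor hp u
  obtain ⟨w, rfl⟩ := hsurj v
  have h0 : axisMap i (k 0) = origin := by
    rw [← hu, ← hB0]; exact (congrFun hpB 0).symm
  refine ⟨i, fderiv ℝ k 0 w 0, ?_⟩
  rw [axisVector, ← map_smul, ← eq_smul_line]
  have hq := isPlot_reparam hp hB
  have hq0 : (p ∘ B) 0 = origin := by rw [← hu, ← hB0]; rfl
  -- The class of `w` for `p ∘ B = axisMap i ∘ k` is pushed forward along `B` to the given vector,
  -- and along `k` to a vector of the axis.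
  rw [tangentClass_comp hp hB hq rfl hB0 hu hq0 w]
  exact (tangentClass_comp (isPlot_axisMap i) hk hq hpB.symm (axisMap_eq_origin h0)
    (axisMap_zero i) hq0 w).symm

/-- Both sides are linear in `ξ`, and classes of plot vectors generate, so only multiples of the
axis vectors need checking; on these the forms `dCoord` act as the dual basis. -/
theorem tangent_origin_eq (ξ : TangentSp origin) :
    ξ = evalForm (dCoord 0) origin ξ • axisVector 0 +
      evalForm (dCoord 1) origin ξ • axisVector 1 := by
  have h : (LinearMap.id : TangentSp origin →ₗ[ℝ] TangentSp origin) =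
      (evalForm (dCoord 0) origin).smulRight (axisVector 0) +
        (evalForm (dCoord 1) origin).smulRight (axisVector 1) := by
    refine tangentSp_linearMap_ext fun P v => ?_
    obtain ⟨i, c, h⟩ := exists_tangentClass_eq_smul P v
    rw [h, map_smul, map_smul]
    congr 1
    fin_cases i
    · simp [evalForm_axisVector_self, evalForm_axisVector_of_ne (by decide : (1 : Fin 2) ≠ 0)]
    · simp [evalForm_axisVector_self, evalForm_axisVector_of_ne (by decide : (0 : Fin 2) ≠ 1)]
  exact congrArg (fun L => L ξ) h

theorem evalForm_dCoord_eq_zero {i j : Fin 2} (h : j ≠ i) {z : Xg} (hz : inclPlane z i ≠ 0) :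
    evalForm (dCoord j) z = 0 := by
  refine tangentSp_linearMap_ext fun P v => ?_
  rw [evalForm_tangentClass, dCoord_eq_zero h _ _ (by simpa [P.map_u] using hz)]
  rfl

/-- The component of a vector field along an axis vanishes at the origin, as it is smooth along the
other axis and zero there off the origin. -/
theorem evalForm_section_origin {s : ∀ z : Xg, TangentSp z}
    (hs : s ∈ sections (fun z : Xg => TangentSp z)) {i j : Fin 2} (h : j ≠ i) :
    evalForm (dCoord j) origin (s origin) = 0 := by
  let φ : ℝ → ℝ := fun t => evalForm (dCoord j) _ (s (axisMap i (line t)))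
  have hφ : Continuous φ :=
    ((dSmooth_evalForm (dCoord j) 1 _ (hs 1 _ (isPlot_axisMap i))).contDiff.comp
      contDiff_line).continuous
  have h1 : φ = fun _ => 0 := by
    -- A continuous function that is zero off `0` is zero, since the complement of a point is dense
    -- in `ℝ`.
    refine hφ.ext_on (dense_compl_singleton 0) continuous_const fun t ht => ?_
    have : inclPlane (axisMap i (line t)) i ≠ 0 := by
      rw [inclPlane_axisMap_self, line_apply]; exact ht
    simp only [φ, evalForm_dCoord_eq_zero h this, LinearMap.zero_apply]
  have h2 : axisMap i (line 0) = origin := by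
    have : line 0 = 0 := by rw [eq_line 0]; simp
    rw [this, axisMap_zero]
  have h3 := congrFun h1 0
  simp only [φ] at h3
  rwa [h2] at h3

end AxesForms

end

theorem proposition5p4 :
    -- `Ω¹(X_g) = {f(x) dx + g(y) dy}`
    {η : Omega1 Xg | ∃ f g : CInf ℝ, η = axesForm f g} = Set.univ ∧
    -- `(f, g) ↦ f(x) dx + g(y) dy` is an isomorphism of diffeological vector spaces
    (∃ Φ : DVSEquiv (CInf ℝ × CInf ℝ) (Omega1 Xg),
      ∀ f g : CInf ℝ, Φ.toLinearEquiv (f, g) = axesForm f g) ∧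
    -- `dx` vanishes off the `x`-axis and `dy` vanishes off the `y`-axis
    (∀ z : Xg, z ∉ Set.range inclX → VanishesAt dx z) ∧
    (∀ z : Xg, z ∉ Set.range inclY → VanishesAt dy z) ∧
    -- the dual tangent bundle has a section that is nonzero at the origin
    (∃ s ∈ sections (fun z : Xg => DualFiber (fun x : Xg => TangentSp x) z), s origin ≠ 0) ∧
    -- every vector field vanishes at the origin
    (∀ s ∈ sections (fun z : Xg => TangentSp z), s origin = 0) := by
  have mem_axis : ∀ (i : Fin 2) (z : Xg), (∀ j ≠ i, inclPlane z j = 0) →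
      z ∈ Set.range (axisMap i) := fun i z h => ⟨_, (eq_axisMap_of_coord h).symm⟩
  refine ⟨?_, ⟨axesFormDVSEquiv, fun f g => rfl⟩, fun z hz n p hp => ?_, fun z hz n p hp => ?_,
    ⟨dualSection (dCoord 0), dualSection_mem_sections _, fun h => ?_⟩, fun s hs => ?_⟩
  · exact Set.eq_univ_of_forall fun η => ⟨_, _, (axesForm_axisCoeff η).symm⟩
  -- `dx` is `dCoord 0` by definition, and a point whose `y`-coordinate is zero would lie on the
  -- `x`-axis.
  · refine dCoord_eq_zero (i := 1) (by decide) p 0 fun h => hz ?_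
    rw [hp] at h
    obtain ⟨t, rfl⟩ := mem_axis 0 z fun j hj => by
      obtain rfl : j = 1 := by omega
      exact h
    exact ⟨t 0, rfl⟩
  · refine dCoord_eq_zero (i := 0) (by decide) p 0 fun h => hz ?_
    rw [hp] at h
    obtain ⟨t, rfl⟩ := mem_axis 1 z fun j hj => by
      obtain rfl : j = 0 := by omega
      exact h
    exact ⟨t 0, rfl⟩
  -- If the section were zero at the origin, `dx` would take both values 0 and 1 on the unit vector
  -- of the `x`-axis.
  · have h1 := evalForm_axisVector_self 0
    have h2 : evalForm (dCoord 0) origin = 0 := congrArg Subtype.val h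
    rw [h2] at h1
    exact zero_ne_one h1
  · rw [tangent_origin_eq (s origin), evalForm_section_origin hs (by decide : (0 : Fin 2) ≠ 1),
      evalForm_section_origin hs (by decide : (1 : Fin 2) ≠ 0)]
    simp
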